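/- Let $\mathscr X_1,\dots,\mathscr X_s$ be finite sets, $\mathscr X=\prod_{t=1}^s\mathscr X_t$, let $g:\mathscr X\to\mathscr Y$ be an arbitrary function, and let $\{X^{(n)}\}_{n\in\mathbb Z}$, $X^{(n)}=(X^{(n)}_1,\dots,X^{(n)}_s)$, be an $\mathscr X$-valued random process. A rate vector $(R_1,\dots,R_s)\in\mathbb R^s$ is *achievable for computing $g$* if for every $\epsilon>0$ there is $N_0$ such that for every $n>N_0$ there are encoders $\phi_t:\mathscr X_t^n\to\{1,\dots,\lfloor 2^{nR_t}\rfloor\}$ ($1\le t\le s$) and a decoder $\psi$ from $\prod_{t}\{1,\dots,\lfloor 2^{nR_t}\rfloor\}$ to $\mathscr Y^n$ with $$\Pr\Big\{\big[g(X^{(1)}),\dots,g(X^{(n)})\big]\ne\psi\big(\phi_1(X_1^{(1)},\dots,X_1^{(n)}),\dots,\phi_s(X_s^{(1)},\dots,X_s^{(n)})\big)\Big\}<\epsilon .$$ Let $\mathcal R[g]$ be the set of achievable rate vectors. A (homogeneous) Markov chain with transition matrix $\mathbf P$ is a process for which, for all $n\ge1$, the conditional law of the $(n+1)$-st variable given the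 variables $1,\dots,n$ is the row of $\mathbf P$ indexed by the $n$-th variable; its initial law is arbitrary. It is irreducible if there is no set $A$ of states, other than the empty set and the whole state space, with $\mathbf P_{A,A^c}=\mathbf 0$. Assume condition (c0): $\{X^{(n)}\}$ is an irreducible Markov chain with state space $\mathscr X$ and transition matrix $\mathbf P_0=c_1\mathbf U+(1-c_1)\mathbf 1$, where $0\le c_1\le1$, $\mathbf 1$ is the identity matrix, and all rows of $\mathbf U$ equal one vector $[u_x]_{x\in\mathscr X}$ with $\sum_x u_x=1$. Then: 1. There exist a finite field $\mathbb F$ and functions $k_t:\mathscr X_t\to\mathbb F$ ($1\le t\le s$), $h:\mathbb F\to\mathscr Y$ such that $$g(x_1,\dots,x_s)=h\Big(\sum_{t=1}^s k_t(x_t)\Big)\quad\text{for all }(x_1,\dots,x_s)\in\mathscr X. \tag{$*$}$$ 2. For every finite field $\mathbb F$ and all functions $k_t:\mathscr X_t\to\mathbb F$, $h:\mathbb F\to\mathscr Y$ satisfying $(*)$, the process $Z^{(n)}=\sum_{t=1}^s k_t(X_t^{(n)})$, with state space the set of values of $\sum_t k_t$, is an irreducible Markov chain with an invariant distribution. If $\mathbf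 P=[p_{i,j}]$ and $\pi=[p_i]$ are its transition matrix and invariant distribution, and $H(\mathbf P|\pi)=-\sum_{i,j}p_i\,p_{i,j}\log_2 p_{i,j}$, then $$\mathcal R_{\mathbb F}=\big\{[R,R,\dots,R]\in\mathbb R^s \,\big|\, R>H(\mathbf P|\pi)\big\}\subseteq\mathcal R[g].$$ Here, for a finite ring $\mathfrak R$ in place of $\mathbb F$, $\mathcal R_{\mathfrak R}=\{[R,\dots,R]\mid R>R_0\}$ with $$R_0=\max_{0\ne\mathfrak I\le_l\mathfrak R}\frac{\log|\mathfrak R|}{\log|\mathfrak I|}\min\Big\{H(\mathbf S_{\mathfrak R/\mathfrak I}|\pi),\;H(\mathbf P|\pi)-\lim_{m\to\infty}H\big(Y^{(m)}_{\mathfrak R/\mathfrak I}\,\big|\,Y^{(m-1)}_{\mathfrak R/\mathfrak I}\big)\Big\},$$ the maximum running over the nonzero left ideals of $\mathfrak R$, where $Y^{(m)}_{\mathfrak R/\mathfrak I}=Z^{(m)}+\mathfrak I$, and $\mathbf S_{\mathfrak R/\mathfrak I}$ is the block diagonal matrix whose blocks are the stochastic complements $\mathbf P_{A,A}+\mathbf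 P_{A,A^c}(\mathbf 1-\mathbf P_{A^c,A^c})^{-1}\mathbf P_{A^c,A}$, with $A$ running over the (nonempty) intersections of the cosets of $\mathfrak I$ with the state space of $Z$. -/

import Mathlib

open scoped Matrix Topology
open MeasureTheory Filter

namespace MarkovCoding

/-! ### Markov chains -/

section Chains

variable {S : Type*} [Fintype S]

/-- `P` is irreducible: there is no set `A` of states with `∅ ≠ A ≠ S` whose block `P_{A, Aᶜ}` is
zero. -/
def Irreducible (P : Matrix S S ℝ) : Prop :=
  ¬ ∃ A : Set S, A ≠ ∅ ∧ A ≠ Set.univ ∧ ∀ i ∈ A, ∀ j ∈ Aᶜ, P i j = 0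

/-- `π` is an invariant distribution of `P`. -/
structure IsInvariant (π : S → ℝ) (P : Matrix S S ℝ) : Prop where
  nonneg : ∀ i, 0 ≤ π i
  sum_eq_one : ∑ i, π i = 1
  invariant : π ᵥ* P = π

/-- The discrete process `X` is a homogeneous Markov chain with transition matrix `P`:
the conditional law of `X⁽ⁿ⁺¹⁾` given `X⁽¹⁾, …, X⁽ⁿ⁾` is the row of `P` at `X⁽ⁿ⁾`, `n ≥ 1`
(the length `n` of the history is written `m + 1`). The initial law is arbitrary. -/
structure IsMarkovChain {Ω : Type*} [MeasurableSpace Ω] (μ : Measure Ω) (X : ℤ → Ω → S)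
    (P : Matrix S S ℝ) : Prop where
  measurable : ∀ n i, MeasurableSet {ω | X n ω = i}
  nonneg : ∀ i j, 0 ≤ P i j
  sum_eq_one : ∀ i, ∑ j, P i j = 1
  markov : ∀ (m : ℕ) (x : Fin (m + 1) → S) (j : S),
    μ.real {ω | (∀ i : Fin (m + 1), X ((i : ℤ) + 1) ω = x i) ∧ X ((m : ℤ) + 2) ω = j} =
      μ.real {ω | ∀ i : Fin (m + 1), X ((i : ℤ) + 1) ω = x i} * P (x (Fin.last m)) j

/-- The conditional entropy `H(P | π)` in bits: `H(V | U)` for a pair with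
`Pr {U = i, V = j} = π i * P i j`. -/
noncomputable def entropyRate (P : Matrix S S ℝ) (π : S → ℝ) : ℝ :=
  -∑ i, ∑ j, π i * P i j * Real.logb 2 (P i j)

open Classical in
/-- The stochastic complement `P_{A,A} + P_{A,Aᶜ} (1 - P_{Aᶜ,Aᶜ})⁻¹ P_{Aᶜ,A}` of `P_{A,A}`
in `P`, for the set `A` of states given by the predicate `A`. -/
noncomputable def stochComplement (P : Matrix S S ℝ) (A : S → Prop) :
    Matrix {i // A i} {i // A i} ℝ :=
  P.toBlock A A + P.toBlock A (fun i => ¬ A i) *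
    (1 - P.toBlock (fun i => ¬ A i) (fun i => ¬ A i))⁻¹ * P.toBlock (fun i => ¬ A i) A

open Classical in
/-- The block diagonal matrix whose blocks are the stochastic complements of the classes of the
partition of the state space into the fibres of `q`. -/
noncomputable def diagComplement {Q : Type*} (P : Matrix S S ℝ) (q : S → Q) : Matrix S S ℝ :=
  Matrix.of fun i j =>
    if h : q j = q i then stochComplement P (fun a => q a = q i) ⟨i, rfl⟩ ⟨j, h⟩ else 0

end Chains

/-- The conditional entropy `H(U | V)`, in bits, of two discrete random variables. -/
noncomputable def condEntropy {Ω α β : Type*} [MeasurableSpace Ω] (μ : Measure Ω)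
    (U : Ω → α) (V : Ω → β) : ℝ :=
  -∑' b, ∑' a, μ.real {ω | U ω = a ∧ V ω = b} *
    Real.logb 2 (μ.real {ω | U ω = a ∧ V ω = b} / μ.real {ω | V ω = b})

/-! ### Source coding for computing a function -/

section Coding

variable {s : ℕ} {𝒳 : Fin s → Type*} {𝒴 Ω : Type*} [MeasurableSpace Ω]

/-- The achievable coding rate region `ℛ[g]` for computing `g`. The encoders of block length `n`
take `⌊2 ^ (n R_t)⌋` values, and they see the data `X_t⁽¹⁾, …, X_t⁽ⁿ⁾`. -/
def achievableRegion (μ : Measure Ω) (X : ℤ → Ω → ∀ t, 𝒳 t) (g : (∀ t, 𝒳 t) → 𝒴) :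
    Set (Fin s → ℝ) :=
  {R | ∀ ε : ℝ, 0 < ε → ∃ N₀ : ℕ, ∀ n : ℕ, N₀ < n →
    ∃ (φ : ∀ t, (Fin n → 𝒳 t) → Fin ⌊(2 : ℝ) ^ ((n : ℝ) * R t)⌋₊)
      (ψ : (∀ t, Fin ⌊(2 : ℝ) ^ ((n : ℝ) * R t)⌋₊) → Fin n → 𝒴),
      μ.real {ω | (fun i : Fin n => g (X ((i : ℤ) + 1) ω)) ≠
        ψ (fun t => φ t (fun i : Fin n => X ((i : ℤ) + 1) ω t))} < ε}

/-- The symmetric rate vectors `[R, R, …, R]` with `R > r`. -/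
def symmetricRegion (s : ℕ) (r : ℝ) : Set (Fin s → ℝ) :=
  {v | ∃ R : ℝ, r < R ∧ v = fun _ => R}

/-- The function `x ↦ ∑ t, k_t (x_t)`. -/
def sumMap {F : Type*} [AddCommMonoid F] (k : ∀ t, 𝒳 t → F) (x : ∀ t, 𝒳 t) : F :=
  ∑ t, k t (x t)

/-- The process `Z⁽ⁿ⁾ = ∑ t, k_t (X_t⁽ⁿ⁾)`; its state space is the set of values of
`∑ t, k_t`. -/
def inducedProcess {F : Type*} [AddCommMonoid F] (k : ∀ t, 𝒳 t → F)
    (X : ℤ → Ω → ∀ t, 𝒳 t) : ℤ → Ω → Set.range (sumMap k) :=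
  fun n ω => ⟨sumMap k (X n ω), X n ω, rfl⟩

/-- The threshold `R₀` of linear coding over a finite ring `A`, for a process `Z` with state space
`K ⊆ A`, transition matrix `P` and invariant distribution `π`: the maximum over the nonzero left
ideals `I` of `log |A| / log |I|` times the minimum of `H(S_{A/I} | π)` and
`H(P | π) - lim H(Y⁽ᵐ⁾ | Y⁽ᵐ⁻¹⁾)`, where `Y⁽ᵐ⁾ = Z⁽ᵐ⁾ + I`. -/
noncomputable def ringThreshold {A : Type*} [Ring A] {K : Set A} [Fintype K] (μ : Measure Ω)
    (Z : ℤ → Ω → K) (P : Matrix K K ℝ) (π : K → ℝ) : ℝ :=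
  ⨆ I : {I : Submodule A A // I ≠ ⊥},
    Real.log (Nat.card A) / Real.log (Nat.card I.1) *
      min (entropyRate (diagComplement P fun z : K => I.1.mkQ (z : A)) π)
        (entropyRate P π - limUnder atTop fun m : ℕ =>
          condEntropy μ (fun ω => I.1.mkQ (Z m ω : A)) (fun ω => I.1.mkQ (Z ((m : ℤ) - 1) ω : A)))

end Coding

end MarkovCoding

/-!
The chain `X` either keeps its state or, with probability `c`, draws it afresh from a positive
distribution `u` (`exists_resamplingMatrix_eq`). This form survives every surjection `q` of the
state space: from `x` the probability of moving into a fibre of `q` depends only on `q x`, so `Z`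
is a Markov chain whose matrix is again of this form, with the image of `u` in place of `u`
(`IsMarkovChain.map_resamplingMatrix`). All entries of this matrix are positive. Hence it is
irreducible, it is the only transition matrix of the process `Z` (`IsMarkovChain.eq_of_pos`), and
the image of `u` is its only invariant distribution (`isInvariant_resamplingMatrix_iff`).

A field has a single nonzero ideal, the whole field. For it the partition into cosets is trivial,
the stochastic complement is the matrix itself, and the process of cosets has entropy zero, so the
threshold is the entropy rate (`ringThreshold_eq_entropyRate`).

Achievability (`const_mem_achievableRegion`) is random linear coding. All encoders apply one matrix
over `F` to their words `k_t (x_t)`, so that the sum of the codewords is the codeword of the word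
of `Z`, and the decoder looks for a typical word of `Z` with that codeword. A random matrix confuses
two given words with probability `|F| ^ (-k)` (`exists_matrix_sum_collision_le`), so it suffices
that the typical set is small, which is a counting argument (`card_typical_le`), and that it has
probability close to one for an arbitrary initial law. The latter is a weak law of large numbers
(`IsMarkovChain.exists_sum_pathProb_lt`). For a chain of the above form Poisson's equation has an
explicit solution (`exists_poisson_resamplingMatrix`). It turns the information of a transition,
centred at the entropy rate, into a bounded martingale increment up to a telescoping term, and
Chebyshev's inequality applies.

The presentation of `g` over a finite field writes the coordinates of `x` into linearly independent
directions of an extension of a large prime field (`exists_field_presentation`).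
-/

namespace MarkovCoding

/-! ### Words of a Markov chain -/

section Words

/-- The probability that `X⁽¹⁾, …, X⁽ⁿ⁾` is the word `x`. -/
noncomputable def pathProb {S Ω : Type*} [MeasurableSpace Ω] (μ : Measure Ω) (X : ℤ → Ω → S)
    {n : ℕ} (x : Fin n → S) : ℝ :=
  μ.real {ω | ∀ i : Fin n, X ((i : ℤ) + 1) ω = x i}

/-- The sum of `f` over the pairs of consecutive letters of the word `x`. -/
def transitionSum {S : Type*} (f : S → S → ℝ) {m : ℕ} (x : Fin (m + 1) → S) : ℝ :=
  ∑ i : Fin m, f (x i.castSucc) (x i.succ)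

theorem transitionSum_snoc {S : Type*} (f : S → S → ℝ) {m : ℕ} (x : Fin (m + 1) → S) (j : S) :
    transitionSum f (Fin.snoc x j : Fin (m + 2) → S) =
      transitionSum f x + f (x (Fin.last m)) j := by
  unfold transitionSum
  rw [Fin.sum_univ_castSucc]
  simp only [Fin.snoc_castSucc, Fin.succ_castSucc, Fin.succ_last, Fin.snoc_last]

theorem sum_word_snoc {S : Type*} [Fintype S] {m : ℕ} (F : (Fin (m + 1) → S) → ℝ) :
    ∑ x, F x = ∑ x : Fin m → S, ∑ j, F (Fin.snoc x j) := by
  rw [← (Fin.snocEquiv fun _ => S).sum_comp, Fintype.sum_prod_type, Finset.sum_comm]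
  rfl

theorem pathProb_nonneg {S Ω : Type*} [MeasurableSpace Ω] {μ : Measure Ω} {X : ℤ → Ω → S}
    {n : ℕ} (x : Fin n → S) : 0 ≤ pathProb μ X x := measureReal_nonneg

theorem pathProb_snoc_eq {S Ω : Type*} [MeasurableSpace Ω] {μ : Measure Ω} {X : ℤ → Ω → S}
    {m : ℕ} (x : Fin (m + 1) → S) (j : S) :
    pathProb μ X (Fin.snoc x j : Fin (m + 2) → S) =
      μ.real {ω | (∀ i : Fin (m + 1), X ((i : ℤ) + 1) ω = x i) ∧ X ((m : ℤ) + 2) ω = j} := by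
  unfold pathProb
  congr 1
  ext ω
  have h : (((m + 1 : ℕ) : ℤ) + 1) = (m : ℤ) + 2 := by push_cast; ring
  simp only [Set.mem_ofPred_eq, Fin.forall_fin_succ' (n := m + 1), Fin.snoc_castSucc,
    Fin.snoc_last, Fin.val_castSucc, Fin.val_last, h]

variable {S Ω : Type*} [Fintype S] [MeasurableSpace Ω] {μ : Measure Ω} [IsProbabilityMeasure μ]
  {X : ℤ → Ω → S} {P : Matrix S S ℝ}

omit [IsProbabilityMeasure μ] in
theorem IsMarkovChain.pathProb_snoc (hX : IsMarkovChain μ X P) {m : ℕ} (x : Fin (m + 1) → S)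
    (j : S) : pathProb μ X (Fin.snoc x j : Fin (m + 2) → S) =
      pathProb μ X x * P (x (Fin.last m)) j := by
  rw [pathProb_snoc_eq, hX.markov]
  rfl

theorem IsMarkovChain.sum_pathProb_filter (hX : IsMarkovChain μ X P) {n : ℕ}
    (p : (Fin n → S) → Prop) [DecidablePred p] :
    ∑ x with p x, pathProb μ X x = μ.real {ω | p fun i : Fin n => X ((i : ℤ) + 1) ω} := by
  classical
  have hfib (x : Fin n → S) : (fun ω (i : Fin n) => X ((i : ℤ) + 1) ω) ⁻¹' {x} =
      {ω | ∀ i : Fin n, X ((i : ℤ) + 1) ω = x i} := by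
    ext ω
    simp [funext_iff]
  have h := sum_measureReal_preimage_singleton (μ := μ) (Finset.univ.filter p)
    (f := fun ω (i : Fin n) => X ((i : ℤ) + 1) ω)
    (fun x _ => by
      rw [hfib, Set.ofPred_forall]
      exact MeasurableSet.iInter fun i => hX.measurable _ _)
    (fun x _ => measure_ne_top _ _)
  simp only [hfib] at h
  refine h.trans ?_
  congr 1
  ext ω
  simp

theorem IsMarkovChain.sum_pathProb (hX : IsMarkovChain μ X P) (n : ℕ) :
    ∑ x : Fin n → S, pathProb μ X x = 1 := by
  have h := hX.sum_pathProb_filter (n := n) (fun _ => True)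
  simpa using h

/-- A Markov chain is lumpable along `q` as soon as the probability of moving from `x` into a fibre
of `q` depends on `x` only through `q x`. -/
theorem IsMarkovChain.map {K : Type*} [Fintype K] (hX : IsMarkovChain μ X P) (q : S → K)
    (Q : Matrix K K ℝ) [DecidableEq K]
    (hQ : ∀ x j, ∑ y with q y = j, P x y = Q (q x) j) (hq : Function.Surjective q) :
    IsMarkovChain μ (fun n ω => q (X n ω)) Q := by
  refine ⟨fun n i => ?_, fun i j => ?_, fun i => ?_, fun m z j => ?_⟩
  · have : {ω | q (X n ω) = i} = ⋃ x ∈ {x | q x = i}, {ω | X n ω = x} := by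
      ext ω
      simp
    rw [this]
    exact MeasurableSet.biUnion (Set.to_countable _) fun x _ => hX.measurable n x
  · obtain ⟨x, rfl⟩ := hq i
    rw [← hQ]
    exact Finset.sum_nonneg fun y _ => hX.nonneg x y
  · obtain ⟨x, rfl⟩ := hq i
    simp_rw [← hQ, Finset.sum_fiberwise]
    exact hX.sum_eq_one x
  · have key {n : ℕ} (z : Fin n → K) : pathProb μ (fun n ω => q (X n ω)) z =
        ∑ x : Fin n → S, if ∀ i, q (x i) = z i then pathProb μ X x else 0 := by
      rw [← Finset.sum_filter, hX.sum_pathProb_filter]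
      rfl
    refine (pathProb_snoc_eq (μ := μ) (X := fun n ω => q (X n ω)) z j).symm.trans ?_
    change _ = pathProb μ (fun n ω => q (X n ω)) z * _
    rw [key, key, sum_word_snoc, Finset.sum_mul]
    refine Finset.sum_congr rfl fun x _ => ?_
    simp only [Fin.forall_fin_succ' (n := m + 1), Fin.snoc_castSucc, Fin.snoc_last,
      hX.pathProb_snoc]
    by_cases hx : ∀ i, q (x i) = z i
    · simp only [hx, implies_true, true_and, if_true]
      rw [← Finset.sum_filter, ← Finset.mul_sum, hQ, hx]
    · simp [hx]

/-- A positive transition matrix is determined by the process, because every state has positive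
probability at time `2`. -/
theorem IsMarkovChain.eq_of_pos {Q : Matrix S S ℝ} (hP : IsMarkovChain μ X P)
    (hQ : IsMarkovChain μ X Q) (hpos : ∀ i j, 0 < Q i j) : P = Q := by
  obtain ⟨z, hz⟩ : ∃ z : Fin 1 → S, 0 < pathProb μ X z := by
    by_contra! h
    have := Finset.sum_nonpos fun z (_ : z ∈ Finset.univ) => h z
    rw [hQ.sum_pathProb] at this
    linarith
  ext i j
  have h₁ := hP.pathProb_snoc (Fin.snoc z i : Fin 2 → S) j
  rw [hQ.pathProb_snoc, Fin.snoc_last, hQ.pathProb_snoc] at h₁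
  exact (mul_left_cancel₀ (mul_pos hz (hpos _ _)).ne' h₁).symm

/-! ### The weak law of large numbers for transitions -/

/-- Martingale increments are orthogonal: the second moment of a sum of `m` of them, each bounded
by `B`, is at most `m * B ^ 2`. -/
theorem IsMarkovChain.sum_pathProb_mul_sq_le (hX : IsMarkovChain μ X P) (D : S → S → ℝ) (B : ℝ)
    (hD : ∀ i, ∑ j, P i j * D i j = 0) (hB : ∀ i j, |D i j| ≤ B) (m : ℕ) :
    ∑ x : Fin (m + 1) → S, pathProb μ X x * transitionSum D x ^ 2 ≤ m * B ^ 2 := by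
  induction m with
  | zero => simp [transitionSum]
  | succ m ih =>
    have hsq (i : S) : ∑ j, P i j * D i j ^ 2 ≤ B ^ 2 := by
      calc ∑ j, P i j * D i j ^ 2 ≤ ∑ j, P i j * B ^ 2 :=
            Finset.sum_le_sum fun j _ => mul_le_mul_of_nonneg_left
              (sq_le_sq' (abs_le.1 (hB i j)).1 (abs_le.1 (hB i j)).2) (hX.nonneg i j)
        _ = B ^ 2 := by rw [← Finset.sum_mul, hX.sum_eq_one, one_mul]
    rw [sum_word_snoc]
    calc ∑ x : Fin (m + 1) → S, ∑ j, pathProb μ X (Fin.snoc x j : Fin (m + 2) → S) *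
          transitionSum D (Fin.snoc x j : Fin (m + 2) → S) ^ 2
        ≤ ∑ x : Fin (m + 1) → S,
            (pathProb μ X x * transitionSum D x ^ 2 + pathProb μ X x * B ^ 2) := by
          refine Finset.sum_le_sum fun x _ => ?_
          set l := x (Fin.last m)
          have : ∑ j, pathProb μ X (Fin.snoc x j : Fin (m + 2) → S) *
              transitionSum D (Fin.snoc x j : Fin (m + 2) → S) ^ 2 =
              pathProb μ X x * (transitionSum D x ^ 2 * ∑ j, P l j +
                2 * transitionSum D x * ∑ j, P l j * D l j + ∑ j, P l j * D l j ^ 2) := by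
            simp only [Finset.mul_sum, ← Finset.sum_add_distrib]
            refine Finset.sum_congr rfl fun j _ => ?_
            rw [hX.pathProb_snoc, transitionSum_snoc]
            ring
          rw [this, hX.sum_eq_one, hD, ← mul_add]
          refine mul_le_mul_of_nonneg_left ?_ (pathProb_nonneg x)
          linarith [hsq l]
      _ ≤ ((m + 1 : ℕ) : ℝ) * B ^ 2 := by
          rw [Finset.sum_add_distrib, ← Finset.sum_mul, hX.sum_pathProb]
          push_cast
          linarith

/-- The upper half of the weak law of large numbers for `f (X⁽ⁱ⁾, X⁽ⁱ⁺¹⁾)`, for an arbitrary initial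
law. The hypothesis is Poisson's equation: `g` turns `f - r` into a martingale increment. -/
theorem IsMarkovChain.exists_sum_pathProb_lt (hX : IsMarkovChain μ X P) (f : S → S → ℝ)
    (g : S → ℝ) (r : ℝ) (hg : ∀ i, ∑ j, P i j * (f i j + g j) = r + g i)
    {δ ε : ℝ} (hδ : 0 < δ) (hε : 0 < ε) :
    ∃ N : ℕ, ∀ m : ℕ, N ≤ m → ∑ x : Fin (m + 1) → S with m * (r + δ) < transitionSum f x,
      pathProb μ X x < ε := by
  set D : S → S → ℝ := fun i j => f i j - r + g j - g i with hDdef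
  have hD (i : S) : ∑ j, P i j * D i j = 0 := by
    have : ∑ j, P i j * D i j = ∑ j, P i j * (f i j + g j) - (r + g i) * ∑ j, P i j := by
      rw [Finset.mul_sum, ← Finset.sum_sub_distrib]
      exact Finset.sum_congr rfl fun j _ => by rw [hDdef]; ring
    rw [this, hg, hX.sum_eq_one]
    ring
  obtain ⟨B, hB⟩ : ∃ B, ∀ i j, |D i j| ≤ B := by
    obtain ⟨B, hB⟩ := (Set.finite_range fun a : S × S => |D a.1 a.2|).bddAbove
    exact ⟨B, fun i j => hB ⟨(i, j), rfl⟩⟩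
  obtain ⟨G, hG⟩ : ∃ G, ∀ i, |g i| ≤ G := by
    obtain ⟨G, hG⟩ := (Set.finite_range fun i => |g i|).bddAbove
    exact ⟨G, fun i => hG ⟨i, rfl⟩⟩
  -- the boundary terms of the telescoping sum of `g` are absorbed
  have htel {m : ℕ} (x : Fin (m + 1) → S) :
      transitionSum f x - m * r - 2 * G ≤ transitionSum D x := by
    have : transitionSum D x =
        transitionSum f x - m * r + (g (x (Fin.last m)) - g (x 0)) := by
      have htele : ∑ i : Fin m, (g (x i.succ) - g (x i.castSucc)) =
          g (x (Fin.last m)) - g (x 0) := by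
        have h₁ := Fin.sum_univ_succ fun i => g (x i)
        have h₂ := Fin.sum_univ_castSucc fun i => g (x i)
        rw [Finset.sum_sub_distrib]
        linarith
      rw [← htele]
      simp only [transitionSum, hDdef, Finset.sum_sub_distrib, Finset.sum_add_distrib,
        Finset.sum_const, Finset.card_univ, Fintype.card_fin, nsmul_eq_mul]
      ring
    have h₁ := abs_le.1 (hG (x (Fin.last m)))
    have h₂ := abs_le.1 (hG (x 0))
    linarith [h₁.1, h₂.2]
  obtain ⟨N, hN⟩ := exists_nat_gt (max (4 * G / δ) (4 * B ^ 2 / (δ ^ 2 * ε)))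
  refine ⟨N, fun m hm => ?_⟩
  have hmN : (N : ℝ) ≤ m := by exact_mod_cast hm
  have hm₁ : 4 * G < m * δ := (div_lt_iff₀ hδ).1 ((le_max_left _ _).trans_lt (hN.trans_le hmN))
  have hm₂ : 4 * B ^ 2 < m * (δ ^ 2 * ε) :=
    (div_lt_iff₀ (by positivity)).1 ((le_max_right _ _).trans_lt (hN.trans_le hmN))
  have hm₀ : (0 : ℝ) < m := by
    refine lt_of_le_of_lt ?_ ((le_max_right _ _).trans_lt (hN.trans_le hmN))
    positivity
  have hcheb : (m * δ / 2) ^ 2 * ∑ x : Fin (m + 1) → S with m * (r + δ) < transitionSum f x,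
      pathProb μ X x ≤ m * B ^ 2 := by
    rw [Finset.mul_sum]
    calc _ ≤ ∑ x : Fin (m + 1) → S with m * (r + δ) < transitionSum f x,
          pathProb μ X x * transitionSum D x ^ 2 := by
            refine Finset.sum_le_sum fun x hx => ?_
            rw [mul_comm]
            refine mul_le_mul_of_nonneg_left ?_ (pathProb_nonneg x)
            have hx := (Finset.mem_filter.1 hx).2
            exact pow_le_pow_left₀ (by positivity) (by linarith [htel x]) 2
      _ ≤ ∑ x : Fin (m + 1) → S, pathProb μ X x * transitionSum D x ^ 2 :=
            Finset.sum_le_sum_of_subset_of_nonneg (Finset.filter_subset _ _) fun x _ _ =>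
              mul_nonneg (pathProb_nonneg x) (sq_nonneg _)
      _ ≤ m * B ^ 2 := hX.sum_pathProb_mul_sq_le D B hD hB m
  by_contra! hcon
  have h₁ := mul_le_mul_of_nonneg_left hcon (sq_nonneg (m * δ / 2))
  have h₂ := mul_lt_mul_of_pos_left hm₂ hm₀
  nlinarith

/-- A typical set: the words of length `m + 1` whose transition probabilities have a product at
least `2 ^ (-a)` number at most `|S| * 2 ^ a`. -/
theorem card_typical_le {P : Matrix S S ℝ} (hpos : ∀ i j, 0 < P i j)
    (hsum : ∀ i, ∑ j, P i j = 1) (m : ℕ) (a : ℝ) :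
    ((Finset.univ.filter fun x : Fin (m + 1) → S =>
      transitionSum (fun i j => -Real.logb 2 (P i j)) x ≤ a).card : ℝ) ≤
      Fintype.card S * (2 : ℝ) ^ a := by
  set f : S → S → ℝ := fun i j => -Real.logb 2 (P i j) with hf
  have htotal (m : ℕ) :
      ∑ x : Fin (m + 1) → S, (2 : ℝ) ^ (-transitionSum f x) = Fintype.card S := by
    induction m with
    | zero => simp [transitionSum]
    | succ m ih =>
      rw [sum_word_snoc, ← ih]
      refine Finset.sum_congr rfl fun x _ => ?_
      rw [← mul_one ((2 : ℝ) ^ (-transitionSum f x)), ← hsum (x (Fin.last m)), Finset.mul_sum]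
      refine Finset.sum_congr rfl fun j _ => ?_
      rw [transitionSum_snoc, neg_add, Real.rpow_add two_pos]
      congr 1
      rw [hf, neg_neg]
      exact Real.rpow_logb two_pos (by norm_num) (hpos _ _)
  set T := Finset.univ.filter fun x : Fin (m + 1) → S => transitionSum f x ≤ a
  have h : (T.card : ℝ) * (2 : ℝ) ^ (-a) ≤ Fintype.card S := by
    rw [← htotal m, ← nsmul_eq_mul]
    refine (Finset.card_nsmul_le_sum T _ _ fun x hx => ?_).trans
      (Finset.sum_le_sum_of_subset_of_nonneg (Finset.filter_subset _ _) fun x _ _ => by positivity)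
    have := (Finset.mem_filter.1 hx).2
    exact Real.rpow_le_rpow_of_exponent_le one_le_two (by linarith)
  rwa [Real.rpow_neg two_pos.le, ← div_eq_mul_inv, div_le_iff₀ (by positivity)] at h

end Words

/-! ### Chains that stay put or are resampled -/

section Resampling

variable {S : Type*} [Fintype S] [DecidableEq S]

/-- The matrix `c U + (1 - c) 1`, where every row of `U` is `u`: with probability `c` the state is
drawn afresh from `u`, otherwise it is kept. -/
def resamplingMatrix (c : ℝ) (u : S → ℝ) : Matrix S S ℝ :=
  c • Matrix.of (fun _ : S => u) + (1 - c) • (1 : Matrix S S ℝ)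

omit [Fintype S] in
theorem resamplingMatrix_apply (c : ℝ) (u : S → ℝ) (i j : S) :
    resamplingMatrix c u i j = c * u j + if i = j then 1 - c else 0 := by
  simp [resamplingMatrix, Matrix.one_apply]

omit [Fintype S] in
theorem resamplingMatrix_pos {c : ℝ} {u : S → ℝ} (hc : 0 < c) (hc₁ : c ≤ 1) (hu : ∀ i, 0 < u i)
    (i j : S) : 0 < resamplingMatrix c u i j := by
  rw [resamplingMatrix_apply]
  have := mul_pos hc (hu j)
  split_ifs <;> linarith

theorem sum_resamplingMatrix_mul (c : ℝ) (u v : S → ℝ) (i : S) :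
    ∑ j, resamplingMatrix c u i j * v j = c * ∑ j, u j * v j + (1 - c) * v i := by
  simp only [resamplingMatrix_apply, add_mul, Finset.sum_add_distrib, ite_mul, zero_mul,
    Finset.sum_ite_eq, Finset.mem_univ, if_true, Finset.mul_sum, mul_assoc]

omit [Fintype S] [DecidableEq S] in
theorem irreducible_of_pos {P : Matrix S S ℝ} (hP : ∀ i j, 0 < P i j) : Irreducible P := by
  rintro ⟨A, hA, hA', h⟩
  obtain ⟨i, hi⟩ := Set.nonempty_iff_ne_empty.2 hA
  obtain ⟨j, hj⟩ := (Set.ne_univ_iff_exists_notMem A).1 hA'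
  exact (hP i j).ne' (h i hi j hj)

theorem vecMul_resamplingMatrix (c : ℝ) (u v : S → ℝ) (hv : ∑ i, v i = 1) :
    v ᵥ* resamplingMatrix c u = c • u + (1 - c) • v := by
  ext j
  simp only [Matrix.vecMul, dotProduct, resamplingMatrix_apply, mul_add, mul_ite, mul_zero,
    Finset.sum_add_distrib, Finset.sum_ite_eq', Finset.mem_univ, if_true, ← Finset.sum_mul, hv,
    Pi.add_apply, Pi.smul_apply, smul_eq_mul]
  ring

theorem isInvariant_resamplingMatrix_iff {c : ℝ} {u v : S → ℝ} (hc : 0 < c) (hu : ∀ i, 0 < u i)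
    (hsum : ∑ i, u i = 1) : IsInvariant v (resamplingMatrix c u) ↔ v = u := by
  constructor
  · intro h
    have h₁ := h.invariant
    rw [vecMul_resamplingMatrix c u v h.sum_eq_one] at h₁
    ext i
    have h₂ := congrFun h₁ i
    simp only [Pi.add_apply, Pi.smul_apply, smul_eq_mul] at h₂
    exact mul_left_cancel₀ hc.ne' (by linarith)
  · rintro rfl
    refine ⟨fun i => (hu i).le, hsum, ?_⟩
    rw [vecMul_resamplingMatrix c v v hsum]
    ext i
    simp only [Pi.add_apply, Pi.smul_apply, smul_eq_mul]
    ring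

/-- An irreducible resampling chain can be presented with a positive resampling probability and a
positive resampling distribution. The parameter `c` changes only if there is a single state. -/
theorem exists_resamplingMatrix_eq [Nonempty S] {c : ℝ} {u : S → ℝ} (hc₀ : 0 ≤ c) (hc₁ : c ≤ 1)
    (hu : ∑ i, u i = 1) (hnn : ∀ i j, 0 ≤ resamplingMatrix c u i j)
    (hirr : Irreducible (resamplingMatrix c u)) :
    ∃ c' : ℝ, 0 < c' ∧ c' ≤ 1 ∧ (∀ i, 0 < u i) ∧
      resamplingMatrix c u = resamplingMatrix c' u := by
  rcases subsingleton_or_nontrivial S with hS | hS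
  · -- with a single state the matrix is `1` for every `c`, and `c` may be `0`
    have hu₁ (i : S) : u i = 1 := by rwa [Fintype.sum_subsingleton u i] at hu
    refine ⟨1, one_pos, le_rfl, fun i => by rw [hu₁]; exact one_pos, ?_⟩
    ext i j
    simp [resamplingMatrix_apply, hu₁, Subsingleton.elim i j]
  · -- the set of all states but `i` can be left
    have hpos (i : S) : c * u i ≠ 0 := by
      intro h
      obtain ⟨j, hj⟩ := exists_ne i
      refine hirr ⟨{i}ᶜ, ?_, ?_, ?_⟩
      · exact (Set.nonempty_of_mem (show j ∈ ({i}ᶜ : Set S) from hj)).ne_empty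
      · exact fun h => (h ▸ Set.mem_univ i : i ∈ ({i}ᶜ : Set S)) rfl
      · intro a ha b hb
        obtain rfl : b = i := by simpa using hb
        rw [resamplingMatrix_apply, h, if_neg (show a ≠ b from ha), add_zero]
    have hc : 0 < c :=
      lt_of_le_of_ne hc₀ fun h => hpos (Classical.arbitrary S) (by rw [← h, zero_mul])
    refine ⟨c, hc, hc₁, fun i => ?_, rfl⟩
    obtain ⟨j, hj⟩ := exists_ne i
    have h := hnn j i
    rw [resamplingMatrix_apply, if_neg hj, add_zero] at h
    exact pos_of_mul_pos_right (lt_of_le_of_ne h (hpos i).symm) hc.le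

omit [DecidableEq S] in
theorem entropyRate_nonneg {P : Matrix S S ℝ} {v : S → ℝ} (hv : ∀ i, 0 ≤ v i)
    (hP : ∀ i j, 0 ≤ P i j) (hsum : ∀ i, ∑ j, P i j = 1) : 0 ≤ entropyRate P v := by
  rw [entropyRate, neg_nonneg]
  refine Finset.sum_nonpos fun i _ => Finset.sum_nonpos fun j _ =>
    mul_nonpos_of_nonneg_of_nonpos (mul_nonneg (hv i) (hP i j)) ?_
  refine Real.logb_nonpos one_lt_two (hP i j) ?_
  rw [← hsum i]
  exact Finset.single_le_sum (fun j _ => hP i j) (Finset.mem_univ j)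

/-- The solution of Poisson's equation for the information of a transition is `g = (f - H) / c`,
where `f i` is the entropy of the row `i`. -/
theorem exists_poisson_resamplingMatrix {c : ℝ} {u : S → ℝ} (hc : 0 < c)
    (hsum : ∑ i, u i = 1) :
    ∃ g : S → ℝ, ∀ i, ∑ j, resamplingMatrix c u i j *
      (-Real.logb 2 (resamplingMatrix c u i j) + g j) =
        entropyRate (resamplingMatrix c u) u + g i := by
  set Q := resamplingMatrix c u with hQ
  set e : S → ℝ := fun i => ∑ j, Q i j * -Real.logb 2 (Q i j) with he
  have hH : ∑ i, u i * e i = entropyRate Q u := by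
    simp only [he, entropyRate, Finset.mul_sum, ← Finset.sum_neg_distrib]
    exact Finset.sum_congr rfl fun i _ => Finset.sum_congr rfl fun j _ => by ring
  refine ⟨fun i => (e i - entropyRate Q u) / c, fun i => ?_⟩
  have hg : ∑ j, u j * ((e j - entropyRate Q u) / c) = 0 := by
    simp only [← mul_div_assoc, mul_sub]
    rw [← Finset.sum_div, Finset.sum_sub_distrib, hH, ← Finset.sum_mul, hsum, one_mul, sub_self,
      zero_div]
  simp only [mul_add, Finset.sum_add_distrib]
  have hQg := sum_resamplingMatrix_mul c u (fun j => (e j - entropyRate Q u) / c) i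
  rw [hg, mul_zero, zero_add, ← hQ] at hQg
  rw [hQg]
  change e i + _ = _
  field_simp
  ring

end Resampling

end MarkovCoding
namespace MarkovCoding

/-! ### Linear codes over a finite field -/

section LinearCodes

/-- A matrix drawn uniformly at random annihilates a nonzero vector with probability
`|F| ^ (-k)`. -/
theorem card_mulVec_eq_zero {F : Type*} [Field F] [Fintype F] [DecidableEq F] (k n : ℕ)
    {v : Fin n → F} (hv : v ≠ 0) :
    (Finset.univ.filter fun A : Matrix (Fin k) (Fin n) F => A *ᵥ v = 0).card *
      Fintype.card F ^ k = Fintype.card (Matrix (Fin k) (Fin n) F) := by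
  let f : Matrix (Fin k) (Fin n) F →+ (Fin k → F) :=
    { toFun := fun A => A *ᵥ v
      map_zero' := Matrix.zero_mulVec v
      map_add' := fun A B => Matrix.add_mulVec A B v }
  have hf : Function.Surjective f := by
    intro b
    obtain ⟨j, hj⟩ := Function.ne_iff.1 hv
    refine ⟨Matrix.of fun i l => if l = j then b i / v j else 0, ?_⟩
    ext i
    simpa [f, Matrix.mulVec, dotProduct] using div_mul_cancel₀ (b i) hj
  have h₁ := AddSubgroup.card_mul_index f.ker
  rw [AddSubgroup.index_ker, AddMonoidHom.range_eq_top.2 hf, AddSubgroup.card_top,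
    Nat.card_eq_fintype_card, Nat.card_eq_fintype_card, Nat.card_eq_fintype_card,
    Fintype.card_fun, Fintype.card_fin] at h₁
  rw [← h₁, Fintype.card_subtype]
  simp only [AddMonoidHom.mem_ker]
  congr!

/-- Random linear coding: for some `k × n` matrix over `F`, the probability that the word drawn
collides with another word of `T` is at most `|T| * |F| ^ (-k)`. -/
theorem exists_matrix_sum_collision_le {F W : Type*} [Field F] [Fintype F] [DecidableEq F]
    [Fintype W] [DecidableEq W] (k n : ℕ) (e : W → Fin n → F) (he : Function.Injective e)
    (T : Finset W) (w : W → ℝ) (hw : ∀ z, 0 ≤ w z) (hsum : ∑ z, w z = 1) :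
    ∃ A : Matrix (Fin k) (Fin n) F,
      ∑ z with ∃ z' ∈ T, z' ≠ z ∧ A *ᵥ e z' = A *ᵥ e z, w z ≤
        T.card / (Fintype.card F : ℝ) ^ k := by
  set N := (Fintype.card (Matrix (Fin k) (Fin n) F) : ℝ) with hN
  have hq : (0 : ℝ) < (Fintype.card F : ℝ) ^ k := by
    have : 0 < Fintype.card F := Fintype.card_pos
    positivity
  have hpair (z z' : W) (hne : z' ≠ z) :
      (∑ A : Matrix (Fin k) (Fin n) F, if A *ᵥ e z' = A *ᵥ e z then (1 : ℝ) else 0) =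
        N / (Fintype.card F : ℝ) ^ k := by
    -- over a field, `A (e z') = A (e z)` says that `A` annihilates the nonzero `e z' - e z`
    rw [eq_div_iff hq.ne', hN,
      ← card_mulVec_eq_zero k n (sub_ne_zero.2 fun h => hne (he h) : e z' - e z ≠ 0)]
    push_cast
    simp [Matrix.mulVec_sub, sub_eq_zero]
  obtain ⟨A, -, hA⟩ := Finset.exists_le_of_sum_le
    (s := (Finset.univ : Finset (Matrix (Fin k) (Fin n) F)))
    (f := fun A => ∑ z with ∃ z' ∈ T, z' ≠ z ∧ A *ᵥ e z' = A *ᵥ e z, w z)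
    (g := fun _ => T.card / (Fintype.card F : ℝ) ^ k) Finset.univ_nonempty (by
      calc ∑ A : Matrix (Fin k) (Fin n) F,
            ∑ z with ∃ z' ∈ T, z' ≠ z ∧ A *ᵥ e z' = A *ᵥ e z, w z
          ≤ ∑ A : Matrix (Fin k) (Fin n) F, ∑ z, ∑ z' ∈ T with z' ≠ z,
              w z * if A *ᵥ e z' = A *ᵥ e z then (1 : ℝ) else 0 := by
            refine Finset.sum_le_sum fun A _ => ?_
            rw [Finset.sum_filter]
            refine Finset.sum_le_sum fun z _ => ?_
            have hnn (z' : W) : 0 ≤ w z * if A *ᵥ e z' = A *ᵥ e z then (1 : ℝ) else 0 :=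
              mul_nonneg (hw z) (by split_ifs <;> norm_num)
            split_ifs with h
            · obtain ⟨z', hz', hne, hc⟩ := h
              have := Finset.single_le_sum (s := T.filter fun z' => z' ≠ z)
                (fun z' _ => hnn z') (Finset.mem_filter.2 ⟨hz', hne⟩)
              simpa [hc] using this
            · exact Finset.sum_nonneg fun z' _ => hnn z'
        _ = ∑ z, ∑ z' ∈ T with z' ≠ z, w z * (N / (Fintype.card F : ℝ) ^ k) := by
            rw [Finset.sum_comm]
            refine Finset.sum_congr rfl fun z _ => ?_
            rw [Finset.sum_comm]
            refine Finset.sum_congr rfl fun z' hz' => ?_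
            rw [← Finset.mul_sum, hpair z z' (Finset.mem_filter.1 hz').2]
        _ ≤ ∑ z, T.card * (w z * (N / (Fintype.card F : ℝ) ^ k)) := by
            refine Finset.sum_le_sum fun z _ => ?_
            rw [Finset.sum_const, nsmul_eq_mul]
            refine mul_le_mul_of_nonneg_right ?_
              (mul_nonneg (hw z) (div_nonneg (Nat.cast_nonneg _) hq.le))
            exact_mod_cast Finset.card_filter_le _ _
        _ = ∑ _A : Matrix (Fin k) (Fin n) F, T.card / (Fintype.card F : ℝ) ^ k := by
            rw [← Finset.mul_sum, ← Finset.sum_mul, hsum, Finset.sum_const, Finset.card_univ,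
              nsmul_eq_mul, ← hN]
            ring)
  exact ⟨A, hA⟩

/-- All encoders apply the same matrix `A`, so that the sum of the codewords is the codeword of the
sum `z`; the decoder looks for a word of `T` with that codeword. -/
theorem exists_encoders_decoder {s : ℕ} {𝒳 : Fin s → Type*} {𝒴 F : Type*} [Field F] [Fintype F]
    {g : (∀ t, 𝒳 t) → 𝒴} {κ : ∀ t, 𝒳 t → F} {h : F → 𝒴} (hg : ∀ x, g x = h (∑ t, κ t (x t)))
    {n k M : ℕ} (hM : Fintype.card F ^ k ≤ M) (A : Matrix (Fin k) (Fin n) F)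
    (T : Finset (Fin n → Set.range (sumMap κ))) :
    ∃ (φ : ∀ t, (Fin n → 𝒳 t) → Fin M) (ψ : (∀ _ : Fin s, Fin M) → Fin n → 𝒴),
      ∀ (x : Fin n → ∀ t, 𝒳 t) (z : Fin n → Set.range (sumMap κ)),
        (∀ i, (z i : F) = sumMap κ (x i)) → z ∈ T →
        (∀ z' ∈ T, (A *ᵥ fun i => (z' i : F)) = (A *ᵥ fun i => (z i : F)) → z' = z) →
        (fun i => g (x i)) = ψ fun t => φ t fun i => x i t := by
  classical
  obtain ⟨ι⟩ : Nonempty ((Fin k → F) ↪ Fin M) :=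
    Function.Embedding.nonempty_of_card_le (by simpa using hM)
  refine ⟨fun t v => ι (A *ᵥ fun i => κ t (v i)), fun c =>
    if hz : ∃ z ∈ T, (A *ᵥ fun i => (z i : F)) = ∑ t, Function.invFun ι (c t) then
      fun i => h (hz.choose i) else fun _ => h 0, fun x z hzx hzT huniq => ?_⟩
  have hsum : ∑ t, Function.invFun ι (ι (A *ᵥ fun i => κ t (x i t))) =
      A *ᵥ fun i => (z i : F) := by
    simp only [Function.leftInverse_invFun ι.injective _]
    rw [← Matrix.mulVec_sum]
    congr 1
    ext i
    rw [hzx, Finset.sum_apply]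
    rfl
  have hz : ∃ z' ∈ T, (A *ᵥ fun i => (z' i : F)) =
      ∑ t, Function.invFun ι (ι (A *ᵥ fun i => κ t (x i t))) := ⟨z, hzT, hsum.symm⟩
  have hchoose : hz.choose = z :=
    huniq _ hz.choose_spec.1 (hz.choose_spec.2.trans hsum)
  simp only [dif_pos hz, hchoose]
  ext i
  rw [hg, hzx]
  rfl

end LinearCodes

/-! ### Achievability -/

/-- The achievability half of coding for the sum process `Z`: above the entropy rate `r` of `Z`, a
random linear code separates the typical words of `Z`. -/
theorem const_mem_achievableRegion {s : ℕ} {𝒳 : Fin s → Type*} {𝒴 F Ω : Type*}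
    [MeasurableSpace Ω] {μ : Measure Ω} [IsProbabilityMeasure μ] {X : ℤ → Ω → ∀ t, 𝒳 t}
    [Field F] [Finite F] {g : (∀ t, 𝒳 t) → 𝒴} {κ : ∀ t, 𝒳 t → F} {h : F → 𝒴}
    (hg : ∀ x, g x = h (∑ t, κ t (x t))) [Fintype (Set.range (sumMap κ))]
    {P : Matrix (Set.range (sumMap κ)) (Set.range (sumMap κ)) ℝ}
    (hZ : IsMarkovChain μ (inducedProcess κ X) P) (hpos : ∀ i j, 0 < P i j)
    {γ : Set.range (sumMap κ) → ℝ} {r R : ℝ} (hr : 0 ≤ r)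
    (hγ : ∀ i, ∑ j, P i j * (-Real.logb 2 (P i j) + γ j) = r + γ i) (hR : r < R) :
    (fun _ => R) ∈ achievableRegion μ X g := by
  classical
  have := Fintype.ofFinite F
  intro ε hε
  set f : Set.range (sumMap κ) → Set.range (sumMap κ) → ℝ := fun i j => -Real.logb 2 (P i j)
  set q := (Fintype.card F : ℝ)
  set C := (Fintype.card (Set.range (sumMap κ)) : ℝ)
  have hq₁ : 1 < q := Nat.one_lt_cast.2 (Fintype.one_lt_card (α := F))
  set δ : ℝ := (R - r) / 2 with hδdef
  have hδ : 0 < δ := by linarith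
  obtain ⟨N₁, hN₁⟩ := hZ.exists_sum_pathProb_lt f γ r hγ hδ (half_pos hε)
  obtain ⟨N₂, hN₂⟩ : ∃ N₂ : ℕ, ∀ m, N₂ ≤ m → C * q * ((2 : ℝ) ^ (-δ)) ^ m < ε / 2 := by
    have hlim := (tendsto_pow_atTop_nhds_zero_of_lt_one (r := (2 : ℝ) ^ (-δ)) (by positivity)
      (Real.rpow_lt_one_of_one_lt_of_neg one_lt_two (neg_lt_zero.2 hδ))).const_mul (C * q)
    rw [mul_zero] at hlim
    exact eventually_atTop.1 (hlim.eventually_lt_const (half_pos hε))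
  refine ⟨max N₁ N₂, fun n hn => ?_⟩
  obtain ⟨m, rfl⟩ : ∃ m, n = m + 1 := ⟨n - 1, by omega⟩
  have hm : max N₁ N₂ ≤ m := by omega
  -- the longest codewords over `F` that fit into `⌊2 ^ (n R)⌋` values
  obtain ⟨k, hk₁, hk₂⟩ := exists_nat_pow_near (x := (2 : ℝ) ^ (((m + 1 : ℕ) : ℝ) * R))
    (Real.one_le_rpow one_le_two (mul_nonneg (Nat.cast_nonneg _) (hr.trans hR.le))) hq₁
  set T := Finset.univ.filter fun z : Fin (m + 1) → Set.range (sumMap κ) =>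
    transitionSum f z ≤ m * (r + δ) with hT
  obtain ⟨A, hA⟩ := exists_matrix_sum_collision_le k (m + 1)
    (fun (z : Fin (m + 1) → Set.range (sumMap κ)) i => (z i : F))
    (fun z z' hz => funext fun i => Subtype.ext (congrFun hz i)) T
    (pathProb μ (inducedProcess κ X)) pathProb_nonneg (hZ.sum_pathProb (m + 1))
  obtain ⟨φ, ψ, hψ⟩ := exists_encoders_decoder hg
    (M := ⌊(2 : ℝ) ^ (((m + 1 : ℕ) : ℝ) * R)⌋₊) (Nat.le_floor (by rwa [Nat.cast_pow])) A T
  refine ⟨φ, ψ, ?_⟩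
  set bad : (Fin (m + 1) → Set.range (sumMap κ)) → Prop := fun z =>
    ∃ z' ∈ T, z' ≠ z ∧ (A *ᵥ fun i => (z' i : F)) = A *ᵥ fun i => (z i : F)
  have hcode : (T.card : ℝ) / q ^ k ≤ C * q * ((2 : ℝ) ^ (-δ)) ^ m := by
    have hcard := card_typical_le hpos hZ.sum_eq_one m (m * (r + δ))
    rw [div_le_iff₀ (by positivity)]
    have hexp : (2 : ℝ) ^ (m * (r + δ)) ≤
        ((2 : ℝ) ^ (-δ)) ^ m * (2 : ℝ) ^ (((m + 1 : ℕ) : ℝ) * R) := by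
      rw [← Real.rpow_natCast, ← Real.rpow_mul two_pos.le, ← Real.rpow_add two_pos]
      refine Real.rpow_le_rpow_of_exponent_le one_le_two ?_
      push_cast
      rw [hδdef]
      nlinarith
    calc (T.card : ℝ) ≤ C * (2 : ℝ) ^ (m * (r + δ)) := hcard
      _ ≤ C * (((2 : ℝ) ^ (-δ)) ^ m * q ^ (k + 1)) := by
          refine mul_le_mul_of_nonneg_left (hexp.trans ?_) (Nat.cast_nonneg _)
          exact mul_le_mul_of_nonneg_left hk₂.le (by positivity)
      _ = C * q * ((2 : ℝ) ^ (-δ)) ^ m * q ^ k := by ring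
  have hsub : {ω | (fun i : Fin (m + 1) => g (X ((i : ℤ) + 1) ω)) ≠
      ψ fun t => φ t fun i : Fin (m + 1) => X ((i : ℤ) + 1) ω t} ⊆
      {ω | m * (r + δ) < transitionSum f fun i : Fin (m + 1) =>
        inducedProcess κ X ((i : ℤ) + 1) ω} ∪
      {ω | bad fun i : Fin (m + 1) => inducedProcess κ X ((i : ℤ) + 1) ω} := by
    intro ω hω
    by_contra hcon
    rw [Set.mem_union, not_or] at hcon
    refine hω (hψ _ (fun i : Fin (m + 1) => inducedProcess κ X ((i : ℤ) + 1) ω)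
      (fun i => rfl) (Finset.mem_filter.2 ⟨Finset.mem_univ _, not_lt.1 hcon.1⟩) ?_)
    intro z' hz' hcoll
    by_contra hne
    exact hcon.2 ⟨z', hz', hne, hcoll⟩
  refine (measureReal_mono hsub (measure_ne_top _ _)).trans_lt
    ((measureReal_union_le _ _).trans_lt ?_)
  rw [← hZ.sum_pathProb_filter fun z => m * (r + δ) < transitionSum f z,
    ← hZ.sum_pathProb_filter bad]
  have h₁ := hN₁ m (le_of_max_le_left hm)
  have h₂ := hN₂ m (le_of_max_le_right hm)
  have h₃ := hA.trans hcode
  linarith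

/-! ### The threshold over a field -/

theorem condEntropy_of_subsingleton {Ω α β : Type*} [MeasurableSpace Ω] (μ : Measure Ω)
    [IsProbabilityMeasure μ] [Subsingleton α] [Subsingleton β] (U : Ω → α) (V : Ω → β) :
    condEntropy μ U V = 0 := by
  have h₁ (a : α) (b : β) : {ω | U ω = a ∧ V ω = b} = Set.univ :=
    Set.eq_univ_of_forall fun ω => ⟨Subsingleton.elim _ _, Subsingleton.elim _ _⟩
  have h₂ (b : β) : {ω | V ω = b} = Set.univ :=
    Set.eq_univ_of_forall fun ω => Subsingleton.elim _ _
  simp [condEntropy, h₁, h₂]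

/-- The stochastic complement of the whole state space is the matrix itself. -/
theorem diagComplement_of_subsingleton {S Q : Type*} [Fintype S] [Subsingleton Q]
    (P : Matrix S S ℝ) (q : S → Q) : diagComplement P q = P := by
  ext i j
  have : IsEmpty {a // ¬ q a = q i} := ⟨fun a => a.2 (Subsingleton.elim _ _)⟩
  simp [diagComplement, stochComplement, Subsingleton.elim (q j) (q i), Matrix.mul_apply]

/-- Over a field the only nonzero ideal is the field itself, and the process of cosets is
constant. -/
theorem ringThreshold_eq_entropyRate {Ω F : Type*} [MeasurableSpace Ω] (μ : Measure Ω)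
    [IsProbabilityMeasure μ] [Field F] [Finite F] {K : Set F} [Fintype K] (Z : ℤ → Ω → K)
    (P : Matrix K K ℝ) (π : K → ℝ) : ringThreshold μ Z P π = entropyRate P π := by
  have : Nonempty {I : Submodule F F // I ≠ ⊥} := ⟨⟨⊤, top_ne_bot⟩⟩
  have hcard : Real.log (Nat.card F) ≠ 0 :=
    (Real.log_pos (by exact_mod_cast Finite.one_lt_card (α := F))).ne'
  unfold ringThreshold
  refine (iSup_congr fun I => ?_).trans (ciSup_const (a := entropyRate P π))
  obtain ⟨I, hI⟩ := I
  obtain rfl : I = ⊤ := (Ideal.eq_bot_or_top I).resolve_left hI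
  have : Subsingleton (F ⧸ (⊤ : Submodule F F)) := Submodule.Quotient.subsingleton_iff.2 rfl
  have htop : Nat.card (⊤ : Submodule F F) = Nat.card F :=
    Nat.card_congr (Equiv.Set.univ F)
  have hent (m : ℕ) := condEntropy_of_subsingleton μ
    (fun ω => (⊤ : Submodule F F).mkQ (Z m ω : F))
    (fun ω => (⊤ : Submodule F F).mkQ (Z ((m : ℤ) - 1) ω : F))
  simp only [hent, htop, div_self hcard, diagComplement_of_subsingleton, one_mul,
    tendsto_const_nhds.limUnder_eq, sub_zero, min_self]

/-! ### Presentation of a function over a finite field -/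

/-- Every function on a finite product is a function of a sum: in a field of dimension more than `s`
over a large prime field, the coordinates are written into linearly independent directions. -/
theorem exists_field_presentation {s : ℕ} {𝒳 : Fin s → Type*} [∀ t, Fintype (𝒳 t)] {𝒴 : Type*}
    [Nonempty 𝒴] (g : (∀ t, 𝒳 t) → 𝒴) :
    ∃ (F : Type) (_ : Field F) (_ : Finite F) (k : ∀ t, 𝒳 t → F) (h : F → 𝒴),
      ∀ x, g x = h (∑ t, k t (x t)) := by
  obtain ⟨p, hp, hprime⟩ := Nat.exists_infinite_primes (∑ t, Fintype.card (𝒳 t))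
  have : Fact p.Prime := ⟨hprime⟩
  have hdim : Module.finrank (ZMod p) (GaloisField p (s + 1)) = s + 1 :=
    GaloisField.finrank p s.succ_ne_zero
  let b := Module.finBasisOfFinrankEq (ZMod p) (GaloisField p (s + 1)) hdim
  let k (t : Fin s) (x : 𝒳 t) : GaloisField p (s + 1) :=
    ((Fintype.equivFin (𝒳 t) x : ℕ) : ZMod p) • b t.castSucc
  have hinj : Function.Injective fun x : ∀ t, 𝒳 t => ∑ t, k t (x t) := by
    intro x y hxy
    have hli : LinearIndependent (ZMod p) fun t : Fin s => b t.castSucc :=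
      b.linearIndependent.comp _ (Fin.castSucc_injective s)
    have hcoef := Fintype.linearIndependent_iffₛ.1 hli _ _ hxy
    ext t
    have hlt (x : 𝒳 t) : (Fintype.equivFin (𝒳 t) x : ℕ) < p :=
      (Fintype.equivFin (𝒳 t) x).2.trans_le
        ((Finset.single_le_sum (fun _ _ => Nat.zero_le _) (Finset.mem_univ t)).trans hp)
    have hval := congrArg ZMod.val (hcoef t)
    rw [ZMod.val_natCast_of_lt (hlt _), ZMod.val_natCast_of_lt (hlt _)] at hval
    exact (Fintype.equivFin (𝒳 t)).injective (Fin.ext hval)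
  refine ⟨GaloisField p (s + 1), inferInstance, inferInstance, k,
    Function.extend (fun x : ∀ t, 𝒳 t => ∑ t, k t (x t)) g fun _ => Classical.arbitrary 𝒴,
    fun x => (hinj.extend_apply g _ x).symm⟩

end MarkovCoding
/-! ### Images of resampling chains -/

namespace MarkovCoding

/-- The image of a resampling chain under a surjection `q` is the resampling chain of the image
distribution. -/
theorem IsMarkovChain.map_resamplingMatrix {S K Ω : Type*} [Fintype S] [DecidableEq S] [Fintype K]
    [DecidableEq K] [MeasurableSpace Ω] {μ : Measure Ω} [IsProbabilityMeasure μ]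
    {X : ℤ → Ω → S} {c : ℝ} {u : S → ℝ} (hX : IsMarkovChain μ X (resamplingMatrix c u))
    {q : S → K} (hq : Function.Surjective q) :
    IsMarkovChain μ (fun n ω => q (X n ω))
      (resamplingMatrix c fun j => ∑ x with q x = j, u x) := by
  refine hX.map q _ (fun x j => ?_) hq
  simp [resamplingMatrix_apply, Finset.sum_add_distrib, Finset.mul_sum]

end MarkovCoding

theorem mainTheorem8 {s : ℕ} {𝒳 : Fin s → Type*} [∀ t, Fintype (𝒳 t)] [∀ t, DecidableEq (𝒳 t)]
    {𝒴 : Type*} {Ω : Type*} [MeasurableSpace Ω] (μ : MeasureTheory.Measure Ω)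
    [MeasureTheory.IsProbabilityMeasure μ]
    (X : ℤ → Ω → ∀ t, 𝒳 t) (g : (∀ t, 𝒳 t) → 𝒴)
    (c₁ : ℝ) (hc₀ : 0 ≤ c₁) (hc₁ : c₁ ≤ 1)
    (u : (∀ t, 𝒳 t) → ℝ) (hu : ∑ x, u x = 1)
    (P₀ : Matrix (∀ t, 𝒳 t) (∀ t, 𝒳 t) ℝ)
    (hP₀ : P₀ = c₁ • Matrix.of (fun _ : ∀ t, 𝒳 t => u) +
      (1 - c₁) • (1 : Matrix (∀ t, 𝒳 t) (∀ t, 𝒳 t) ℝ))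
    (hX : MarkovCoding.IsMarkovChain μ X P₀) (hirr : MarkovCoding.Irreducible P₀) :
    (∃ (F : Type) (_ : Field F) (_ : Finite F) (k : ∀ t, 𝒳 t → F) (h : F → 𝒴),
      ∀ x, g x = h (∑ t, k t (x t))) ∧
    ∀ (F : Type*) [Field F] [Finite F] [DecidableEq F] (k : ∀ t, 𝒳 t → F) (h : F → 𝒴),
      (∀ x, g x = h (∑ t, k t (x t))) →
      (∃ (P : Matrix (Set.range (MarkovCoding.sumMap k)) (Set.range (MarkovCoding.sumMap k)) ℝ)
          (π : Set.range (MarkovCoding.sumMap k) → ℝ),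
        MarkovCoding.IsMarkovChain μ (MarkovCoding.inducedProcess k X) P ∧
        MarkovCoding.Irreducible P ∧ MarkovCoding.IsInvariant π P) ∧
      ∀ (P : Matrix (Set.range (MarkovCoding.sumMap k)) (Set.range (MarkovCoding.sumMap k)) ℝ)
          (π : Set.range (MarkovCoding.sumMap k) → ℝ),
        MarkovCoding.IsMarkovChain μ (MarkovCoding.inducedProcess k X) P →
        MarkovCoding.Irreducible P → MarkovCoding.IsInvariant π P →
        MarkovCoding.symmetricRegion s
            (MarkovCoding.ringThreshold μ (MarkovCoding.inducedProcess k X) P π) =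
          MarkovCoding.symmetricRegion s (MarkovCoding.entropyRate P π) ∧
        MarkovCoding.symmetricRegion s (MarkovCoding.entropyRate P π) ⊆
          MarkovCoding.achievableRegion μ X g := by
  classical
  have hΩ : Nonempty Ω := nonempty_of_isProbabilityMeasure μ
  have hne : Nonempty (∀ t, 𝒳 t) := hΩ.map (X 0)
  have h𝒴 : Nonempty 𝒴 := hne.map g
  refine ⟨MarkovCoding.exists_field_presentation g, ?_⟩
  intro F _ _ _ k h hg
  obtain rfl : P₀ = MarkovCoding.resamplingMatrix c₁ u := by
    rw [hP₀]
    ext x y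
    simp only [MarkovCoding.resamplingMatrix, Matrix.add_apply, Matrix.smul_apply, Matrix.of_apply,
      Matrix.one_apply]
  obtain ⟨c, hc, hc', hupos, hPc⟩ :=
    MarkovCoding.exists_resamplingMatrix_eq hc₀ hc₁ hu hX.nonneg hirr
  rw [hPc] at hX
  have hq := Set.rangeFactorization_surjective (f := MarkovCoding.sumMap k)
  set v : Set.range (MarkovCoding.sumMap k) → ℝ :=
    fun j => ∑ x with Set.rangeFactorization (MarkovCoding.sumMap k) x = j, u x with hv
  have hvpos (j) : 0 < v j := by
    obtain ⟨x, hx⟩ := hq j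
    exact Finset.sum_pos (fun x _ => hupos x) ⟨x, by simpa using hx⟩
  have hvsum : ∑ j, v j = 1 := by rw [hv, Finset.sum_fiberwise, hu]
  have hZ : MarkovCoding.IsMarkovChain μ (MarkovCoding.inducedProcess k X)
      (MarkovCoding.resamplingMatrix c v) := hX.map_resamplingMatrix hq
  have hpos := MarkovCoding.resamplingMatrix_pos hc hc' hvpos
  have hinv := MarkovCoding.isInvariant_resamplingMatrix_iff (v := v) hc hvpos hvsum
  refine ⟨⟨_, v, hZ, MarkovCoding.irreducible_of_pos hpos, hinv.2 rfl⟩, ?_⟩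
  intro P π hP _ hπ
  -- the chain determines both its transition matrix and its invariant distribution
  obtain rfl := hP.eq_of_pos hZ hpos
  obtain rfl := (MarkovCoding.isInvariant_resamplingMatrix_iff hc hvpos hvsum).1 hπ
  refine ⟨by rw [MarkovCoding.ringThreshold_eq_entropyRate], ?_⟩
  rintro _ ⟨R, hR, rfl⟩
  obtain ⟨γ, hγ⟩ := MarkovCoding.exists_poisson_resamplingMatrix (c := c) hc hvsum
  exact MarkovCoding.const_mem_achievableRegion hg hZ hpos
    (MarkovCoding.entropyRate_nonneg hπ.nonneg hZ.nonneg hZ.sum_eq_one) hγ hR
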